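/- Let $n \ge r > \ell$ be positive integers and $[n]=\{1,\dots,n\}$. An $r$-uniform hypergraph $H$ on $[n]$ is a set of $r$-element subsets of $[n]$ (its hyperedges). For $i \in \{0,\dots,\ell-1\}$ let $F_{r,i}$ be the $r$-uniform hypergraph on $2r-i$ vertices with two hyperedges sharing exactly $i$ vertices, and let $\mathcal{B}_{r,\ell}=\{F_{r,i} : i=0,\dots,\ell-1\}$. Let $\mathrm{ex}(n,\mathcal{B}_{r,\ell})$ be the largest number of hyperedges in an $r$-uniform hypergraph on $[n]$ that contains no copy of any member of $\mathcal{B}_{r,\ell}$; an $r$-uniform hypergraph on $[n]$ that contains no such copy and has exactly $\mathrm{ex}(n,\mathcal{B}_{r,\ell})$ hyperedges is called extremal for $\mathrm{ex}(n,\mathcal{B}_{r,\ell})$. A $(k,\ell)$-Kneser coloring of $H$ is a map from the set of hyperedges of $H$ to $\{1,\dots,k\}$ such that any two distinct hyperedges of the same color share at least $\ell$ vertices. Let $\kappa(H,k,\ell)$ be the number of $(k,\ell)$-Kneser colorings of $H$, and let $\mathrm{KC}(n,r,k,\ell)$ be the maximum of $\kappa(H,k,\ell)$ over all $r$-uniform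 hypergraphs $H$ on $[n]$. Then $$\mathrm{KC}(n,r,2,\ell) = 2^{\mathrm{ex}(n,\mathcal{B}_{r,\ell})}.$$ Every $r$-uniform hypergraph $H$ on $[n]$ that is extremal for $\mathrm{ex}(n,\mathcal{B}_{r,\ell})$ satisfies $\kappa(H,2,\ell)=\mathrm{KC}(n,r,2,\ell)$. Moreover, unless $\ell=1$ and $n=2r$, every $r$-uniform hypergraph $H$ on $[n]$ with $\kappa(H,2,\ell)=\mathrm{KC}(n,r,2,\ell)$ is extremal for $\mathrm{ex}(n,\mathcal{B}_{r,\ell})$. -/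

import Mathlib

/-- A hypergraph with (finite) vertex set `V`, given by its finite set of hyperedges `e ⊆ V`. -/
abbrev FinHypergraph (V : Type*) := Finset (Finset V)

namespace FinHypergraph

/-- `H` is `r`-uniform: every hyperedge has exactly `r` vertices. -/
def IsUniform {V : Type*} (H : FinHypergraph V) (r : ℕ) : Prop :=
  ∀ e ∈ H, e.card = r

/-- `H` contains a copy of `F`: some injection of the vertices of `F` into the vertices of `H`
maps every hyperedge of `F` to a hyperedge of `H`. -/
def ContainsCopy {V W : Type*} (H : FinHypergraph V) (F : FinHypergraph W) : Prop :=
  ∃ φ : W ↪ V, ∀ e ∈ F, e.map φ ∈ H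

/-- `H` contains no copy of any member of the family `𝓑` of finite hypergraphs. -/
def IsFree {V : Type*} (H : FinHypergraph V) (𝓑 : Set (Σ m : ℕ, FinHypergraph (Fin m))) : Prop :=
  ∀ F ∈ 𝓑, ¬ H.ContainsCopy F.2

/-- `F_{r,i}`: the hypergraph on `2r - i` vertices `0, …, 2r - i - 1` whose two hyperedges are
the first `r` vertices and the last `r` vertices; for `i < r` these share exactly the `i`
vertices `r - i, …, r - 1`. -/
def twoEdges (r i : ℕ) : FinHypergraph (Fin (2 * r - i)) :=
  {Finset.univ.filter (fun v : Fin (2 * r - i) => (v : ℕ) < r),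
    Finset.univ.filter (fun v : Fin (2 * r - i) => r - i ≤ (v : ℕ))}

/-- The family `𝓑_{r,ℓ} = {F_{r,i} : i = 0, …, ℓ - 1}`. -/
def nonIntersectingPairs (r ℓ : ℕ) : Set (Σ m : ℕ, FinHypergraph (Fin m)) :=
  {F | ∃ i < ℓ, F = ⟨2 * r - i, twoEdges r i⟩}

open Classical in
/-- The Turán number `ex(n, 𝓑)` for `r`-uniform hypergraphs: the maximum number of hyperedges in
an `r`-uniform hypergraph on `n` vertices that contains no copy of a member of `𝓑`. -/
noncomputable def ex (n r : ℕ) (𝓑 : Set (Σ m : ℕ, FinHypergraph (Fin m))) : ℕ :=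
  (Finset.univ.filter fun H : FinHypergraph (Fin n) => H.IsUniform r ∧ H.IsFree 𝓑).sup Finset.card

/-- `H` is an extremal `r`-uniform hypergraph for `ex(n, 𝓑)`. -/
def IsExtremal {n : ℕ} (H : FinHypergraph (Fin n)) (r : ℕ)
    (𝓑 : Set (Σ m : ℕ, FinHypergraph (Fin m))) : Prop :=
  H.IsUniform r ∧ H.IsFree 𝓑 ∧ H.card = ex n r 𝓑

/-- A `(k, ℓ)`-Kneser coloring of `H`: a coloring of the hyperedges with `k` colors (not all of
which need be used) such that any two distinct hyperedges of the same color share at least `ℓ`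
vertices. -/
def IsKneserColoring {V : Type*} [DecidableEq V] (H : FinHypergraph V) (k ℓ : ℕ)
    (Δ : {e // e ∈ H} → Fin k) : Prop :=
  ∀ e f : {e // e ∈ H}, e ≠ f → Δ e = Δ f → ℓ ≤ (e.1 ∩ f.1).card

/-- `κ(H, k, ℓ)`: the number of `(k, ℓ)`-Kneser colorings of `H`. -/
noncomputable def kappa {V : Type*} [DecidableEq V] (H : FinHypergraph V) (k ℓ : ℕ) : ℕ :=
  Nat.card {Δ : {e // e ∈ H} → Fin k // H.IsKneserColoring k ℓ Δ}

open Classical in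
/-- `KC(n, r, k, ℓ)`: the maximum of `κ(H, k, ℓ)` over all `r`-uniform hypergraphs `H` on `n`
vertices. -/
noncomputable def KC (n r k ℓ : ℕ) : ℕ :=
  (Finset.univ.filter fun H : FinHypergraph (Fin n) => H.IsUniform r).sup fun H => H.kappa k ℓ

end FinHypergraph

namespace FinHypergraph

open Finset

/-! Join two hyperedges of `H` when they share fewer than `ℓ` vertices. A Kneser coloring with two
colors is a proper 2-coloring of this conflict graph, so it is fixed by its values on one hyperedge
per component (`kappa_two_le`). Such representatives are pairwise non-adjacent, hence form an
`ℓ`-intersecting family, and there are at most `ex` components. An extremal `H` has no conflicts, so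
all its `2 ^ ex` colorings count.

For uniqueness, suppose equality holds but some `e`, `f` conflict. They lie in one component, so
exchanging `e` for `f` in a system of representatives turns one maximum intersecting family into
another that differs in a single member. `not_nearTwins` excludes this unless `ℓ = 1` and `n = 2r`:
shifting preserves such a pair, so both families may be taken stable, and stable maximum families
are determined by the first `2r - ℓ` elements. The borderline `n = 2r - ℓ + 1` is handled by
complements. -/

/-- A family of `r`-sets any two of which share at least `ℓ` elements. -/
def IsIntersectingFamily {V : Type*} [DecidableEq V] (r ℓ : ℕ) (F : Finset (Finset V)) : Prop :=
  (∀ e ∈ F, e.card = r) ∧ ∀ e ∈ F, ∀ f ∈ F, ℓ ≤ (e ∩ f).card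

/-- An intersecting family of maximum size. -/
def IsMaxIntersecting {V : Type*} [DecidableEq V] (r ℓ : ℕ) (F : Finset (Finset V)) : Prop :=
  IsIntersectingFamily r ℓ F ∧ ∀ G : Finset (Finset V), IsIntersectingFamily r ℓ G → G.card ≤ F.card

/-- The families `I` and `J` are distinct and have all but at most one member of `I` in common. -/
def NearTwins {V : Type*} [DecidableEq V] (I J : Finset (Finset V)) : Prop :=
  I ≠ J ∧ I.card ≤ (I ∩ J).card + 1

/-! ### Shifting intersecting families and near twins. -/

section Shift

variable {V : Type*} [DecidableEq V] {r ℓ : ℕ} {x y : V} {F G I J : Finset (Finset V)}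

theorem compress_singleton (x y : V) (a : Finset V) :
    UV.compress {x} {y} a = if x ∉ a ∧ y ∈ a then insert x (a.erase y) \ {y} else a := by
  unfold UV.compress
  by_cases h : x ∉ a ∧ y ∈ a
  · rw [if_pos h, if_pos (by simpa using h)]
    ext z
    simp only [sup_eq_union, mem_sdiff, mem_union, mem_singleton, mem_insert, mem_erase]
    tauto
  · rw [if_neg h, if_neg (by simpa using h)]

theorem card_inter_shift_both {a b : Finset V} (ha : x ∉ a ∧ y ∈ a) (hb : x ∉ b ∧ y ∈ b) :
    ((insert x (a.erase y) \ {y}) ∩ (insert x (b.erase y) \ {y})).card = (a ∩ b).card := by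
  have hxy : x ≠ y := by rintro rfl; exact ha.1 ha.2
  have : (insert x (a.erase y) \ {y}) ∩ (insert x (b.erase y) \ {y})
      = insert x ((a ∩ b).erase y) := by
    ext z
    by_cases h : z = x
    · subst h; simp [hxy]
    · simp only [mem_inter, mem_sdiff, mem_insert, mem_erase, mem_singleton]; tauto
  rw [this, card_insert_of_notMem (by simp [ha.1]),
    card_erase_add_one (mem_inter.2 ⟨ha.2, hb.2⟩)]

/-- The hypothesis on the shift of `a` is needed only when `a` contains `y` but not `x`: then `a`
loses `y` from the intersection, but the shift of `a` meets `b` inside `a` and the shifted `b`. A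
set that survives compression unmoved has its shift in the family, which supplies this hypothesis.
-/
theorem le_card_inter_shift {a b : Finset V} (hb : x ∉ b ∧ y ∈ b)
    (h : ℓ ≤ (a ∩ b).card) (h' : ℓ ≤ (UV.compress {x} {y} a ∩ b).card) :
    ℓ ≤ (a ∩ (insert x (b.erase y) \ {y})).card := by
  have hxy : x ≠ y := by rintro rfl; exact hb.1 hb.2
  rw [compress_singleton] at h'
  by_cases hy : y ∈ a
  · by_cases hx : x ∈ a
    · have : a ∩ (insert x (b.erase y) \ {y}) = insert x ((a ∩ b).erase y) := by
        ext z
        by_cases h : z = x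
        · subst h; simp [hxy, hx]
        · simp only [mem_inter, mem_sdiff, mem_insert, mem_erase, mem_singleton]; tauto
      rw [this, card_insert_of_notMem (by simp [hb.1]),
        card_erase_add_one (mem_inter.2 ⟨hy, hb.2⟩)]
      exact h
    · rw [if_pos ⟨hx, hy⟩] at h'
      refine h'.trans (card_le_card fun z hz => ?_)
      simp only [mem_inter, mem_sdiff, mem_insert, mem_erase, mem_singleton] at hz ⊢
      have : z ≠ x := by rintro rfl; exact hb.1 hz.2
      tauto
  · refine h.trans (card_le_card fun z hz => ?_)
    simp only [mem_inter, mem_sdiff, mem_insert, mem_erase, mem_singleton] at hz ⊢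
    have : z ≠ y := by rintro rfl; exact hy hz.1
    tauto

theorem mem_compression_singleton {e : Finset V} (h : e ∈ UV.compression {x} {y} F) :
    (e ∈ F ∧ UV.compress {x} {y} e ∈ F) ∨
      ∃ b ∈ F, (x ∉ b ∧ y ∈ b) ∧ e = insert x (b.erase y) \ {y} := by
  rw [UV.mem_compression] at h
  rcases h with h | ⟨h, b, hb, rfl⟩
  · exact .inl h
  · rw [compress_singleton] at h ⊢
    by_cases hc : x ∉ b ∧ y ∈ b
    · exact .inr ⟨b, hb, hc, if_pos hc⟩
    · rw [if_neg hc] at h; exact absurd hb h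

theorem IsIntersectingFamily.compression (h : IsIntersectingFamily r ℓ F) (x y : V) :
    IsIntersectingFamily r ℓ (UV.compression {x} {y} F) := by
  refine ⟨fun e he => Set.Sized.uvCompression (by simp) (fun a ha => h.1 a ha) he, ?_⟩
  intro e he f hf
  rcases mem_compression_singleton he with ⟨he, he'⟩ | ⟨a, ha, hc, rfl⟩ <;>
  rcases mem_compression_singleton hf with ⟨hf, hf'⟩ | ⟨b, hb, hd, rfl⟩
  · exact h.2 e he f hf
  · exact le_card_inter_shift hd (h.2 e he b hb) (h.2 _ he' b hb)
  · rw [inter_comm]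
    exact le_card_inter_shift hc (h.2 f hf a ha) (h.2 _ hf' a ha)
  · rw [card_inter_shift_both hc hd]
    exact h.2 a ha b hb

theorem IsMaxIntersecting.compression (h : IsMaxIntersecting r ℓ F) (x y : V) :
    IsMaxIntersecting r ℓ (UV.compression {x} {y} F) :=
  ⟨h.1.compression x y, by simpa using h.2⟩

theorem compression_mono (x y : V) (h : F ⊆ G) :
    UV.compression {x} {y} F ⊆ UV.compression {x} {y} G := by
  intro e he
  rw [UV.mem_compression] at he ⊢
  rcases he with ⟨h1, h2⟩ | ⟨_, b, hb, rfl⟩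
  · exact .inl ⟨h h1, h h2⟩
  · by_cases hG : UV.compress {x} {y} b ∈ G
    · exact .inl ⟨hG, by rwa [UV.compress_idem]⟩
    · exact .inr ⟨hG, b, h hb, rfl⟩

/-- Distinct near twins of maximum size have members that share fewer than `ℓ` elements. -/
theorem IsMaxIntersecting.card_inter_lt (hI : IsMaxIntersecting r ℓ I)
    (hJ : IsIntersectingFamily r ℓ J) (hIJ : NearTwins I J) (hℓ : ℓ ≤ r) {e f : Finset V}
    (he : e ∈ I) (heJ : e ∉ J) (hf : f ∈ J) (hfI : f ∉ I) : (e ∩ f).card < ℓ := by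
  by_contra! hc
  -- Only `e` separates `I` from `I ∩ J`, so if `e` met `f` in `ℓ` elements, `f` could be added to
  -- the maximum family `I`.
  have hins : insert e (I ∩ J) = I := by
    apply eq_of_subset_of_card_le
    · intro g; simp only [mem_insert, mem_inter]; rintro (rfl | h) <;> tauto
    · rw [card_insert_of_notMem (by simp [heJ])]; exact hIJ.2
  have hall : ∀ g ∈ I, ℓ ≤ (g ∩ f).card := by
    intro g hg
    rw [← hins, mem_insert] at hg
    rcases hg with rfl | hg
    · exact hc
    · exact hJ.2 g (mem_inter.1 hg).2 f hf
  have := hI.2 (insert f I) ⟨?_, ?_⟩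
  · rw [card_insert_of_notMem hfI] at this; omega
  · simp only [mem_insert]; rintro g (rfl | hg)
    · exact hJ.1 g hf
    · exact hI.1.1 g hg
  · simp only [mem_insert]; rintro g (rfl | hg) h (rfl | hh)
    · rw [inter_self, hJ.1 _ hf]; exact hℓ
    · rw [inter_comm]; exact hall h hh
    · exact hall g hg
    · exact hI.1.2 g hg h hh

theorem NearTwins.symm (h : NearTwins I J) (hc : I.card = J.card) : NearTwins J I :=
  ⟨h.1.symm, by rw [inter_comm, ← hc]; exact h.2⟩

theorem NearTwins.exists_mem (h : NearTwins I J) (hc : I.card = J.card) : ∃ e ∈ I, e ∉ J := by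
  by_contra! hs
  exact h.1 (eq_of_subset_of_card_le hs hc.ge)

/-- Compression acts separately on each fibre of `UV.compress`, so equal compressions force equal
fibre sizes. -/
theorem compression_filter (x y : V) (F : Finset (Finset V)) (Q : Finset V → Prop)
    [DecidablePred Q] (hQ : ∀ a, Q (UV.compress {x} {y} a) ↔ Q a) :
    UV.compression {x} {y} (F.filter Q) = (UV.compression {x} {y} F).filter Q := by
  ext a
  simp only [UV.mem_compression, mem_filter, hQ]
  constructor
  · rintro (h | ⟨h, b, ⟨hb, hbQ⟩, rfl⟩)
    · tauto
    · rw [hQ] at h ⊢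
      exact ⟨.inr ⟨by tauto, b, hb, rfl⟩, hbQ⟩
  · rintro ⟨h | ⟨h, b, hb, rfl⟩, ha⟩
    · tauto
    · exact .inr ⟨by tauto, b, ⟨hb, (hQ b).1 ha⟩, rfl⟩

theorem card_le_card_inter_of_compress_eq {a b : Finset V} (hab : a.card = b.card)
    (h : UV.compress {x} {y} a = UV.compress {x} {y} b) : a.card ≤ (a ∩ b).card + 1 := by
  have key : ∀ a b : Finset V, UV.compress {x} {y} a = UV.compress {x} {y} b →
      (x ∉ a ∧ y ∈ a) → a.card ≤ (a ∩ b).card + 1 := by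
    intro a b h ha
    have : a.erase y ⊆ a ∩ b := by
      intro z hz
      rw [mem_erase] at hz
      have hza : z ∈ UV.compress {x} {y} a := by
        rw [compress_singleton, if_pos ha]; simp [hz.1, hz.2]
      have hzx : z ≠ x := by rintro rfl; exact ha.1 hz.2
      rw [h, compress_singleton] at hza
      split_ifs at hza
      · simp only [mem_sdiff, mem_insert, mem_erase, mem_singleton] at hza
        simp only [mem_inter]; tauto
      · exact mem_inter.2 ⟨hz.2, hza⟩
    have := card_le_card this
    rw [card_erase_of_mem ha.2] at this
    omega
  by_cases ha : x ∉ a ∧ y ∈ a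
  · exact key a b h ha
  by_cases hb : x ∉ b ∧ y ∈ b
  · rw [hab, inter_comm]; exact key b a h.symm hb
  · rw [compress_singleton, compress_singleton, if_neg ha, if_neg hb] at h
    simp [h]

/-- The point is that the shifts stay distinct. If they coincided, the fibre of `e ∈ I \ J` would
have the same size in `I` and in `J`, giving `b ∈ J \ I` with the same shift as `e`. Then `e` and
`b` share at least `r - 1 ≥ ℓ` elements, against `card_inter_lt`. -/
theorem NearTwins.compression (hIJ : NearTwins I J) (hI : IsMaxIntersecting r ℓ I)
    (hJ : IsMaxIntersecting r ℓ J) (hℓ : ℓ < r) (x y : V) :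
    NearTwins (UV.compression {x} {y} I) (UV.compression {x} {y} J) := by
  have hc : I.card = J.card := le_antisymm (hJ.2 _ hI.1) (hI.2 _ hJ.1)
  constructor
  · intro heq
    obtain ⟨e, he, heJ⟩ := hIJ.exists_mem hc
    let Q : Finset V → Prop := fun a => UV.compress {x} {y} a = UV.compress {x} {y} e
    have hQ : ∀ a, Q (UV.compress {x} {y} a) ↔ Q a := by simp [Q]
    have hcard : (I.filter Q).card = (J.filter Q).card := by
      rw [← UV.card_compression {x} {y}, compression_filter x y I Q hQ, heq,
        ← compression_filter x y J Q hQ, UV.card_compression]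
    obtain ⟨b, hb, hbI⟩ : ∃ b ∈ J.filter Q, b ∉ I.filter Q := by
      by_contra! hs
      have := eq_of_subset_of_card_le hs hcard.le
      have : e ∈ J.filter Q := this ▸ mem_filter.2 ⟨he, rfl⟩
      exact heJ (mem_filter.1 this).1
    rw [mem_filter] at hb
    have hbI : b ∉ I := fun h => hbI (mem_filter.2 ⟨h, hb.2⟩)
    have h1 := hI.card_inter_lt hJ.1 hIJ hℓ.le he heJ hb.1 hbI
    have h2 := card_le_card_inter_of_compress_eq
      ((hI.1.1 e he).trans (hJ.1.1 b hb.1).symm) hb.2.symm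
    rw [hI.1.1 e he] at h2
    omega
  · rw [UV.card_compression]
    refine hIJ.2.trans ?_
    have : UV.compression {x} {y} (I ∩ J) ⊆
        UV.compression {x} {y} I ∩ UV.compression {x} {y} J :=
      subset_inter (compression_mono x y inter_subset_left) (compression_mono x y inter_subset_right)
    have := card_le_card this
    rw [UV.card_compression] at this
    omega

end Shift

/-! ### Stable families, and the impossibility of near twins. -/

section Stable

variable {n r ℓ : ℕ} {F I J : Finset (Finset (Fin n))}

/-- The sum of all elements of all members of a family. -/
def weight (F : Finset (Finset (Fin n))) : ℕ := ∑ e ∈ F, ∑ i ∈ e, (i : ℕ)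

/-- A family that is closed under replacing an element of a member by a smaller one. -/
def IsStable (F : Finset (Finset (Fin n))) : Prop :=
  ∀ e ∈ F, ∀ x y, x < y → x ∉ e → y ∈ e → insert x (e.erase y) ∈ F

theorem sum_shift_lt {e : Finset (Fin n)} {x y : Fin n} (hxy : x < y) (hx : x ∉ e) (hy : y ∈ e) :
    ∑ i ∈ insert x (e.erase y), (i : ℕ) < ∑ i ∈ e, (i : ℕ) := by
  rw [sum_insert (by simp [hx]), ← add_sum_erase e _ hy]
  exact Nat.add_lt_add_right hxy _

theorem compress_singleton_of_mem {e : Finset (Fin n)} {x y : Fin n} (hx : x ∉ e) (hy : y ∈ e) :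
    UV.compress {x} {y} e = insert x (e.erase y) := by
  rw [compress_singleton, if_pos ⟨hx, hy⟩, sdiff_singleton_eq_erase, erase_insert_of_ne,
    erase_idem]
  rintro rfl; exact hx hy

theorem sum_compress_le {x y : Fin n} (hxy : x < y) (e : Finset (Fin n)) :
    ∑ i ∈ UV.compress {x} {y} e, (i : ℕ) ≤ ∑ i ∈ e, (i : ℕ) := by
  by_cases h : x ∉ e ∧ y ∈ e
  · rw [compress_singleton_of_mem h.1 h.2]; exact (sum_shift_lt hxy h.1 h.2).le
  · rw [compress_singleton, if_neg h]

theorem weight_compression (x y : Fin n) (F : Finset (Finset (Fin n))) :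
    weight (UV.compression {x} {y} F) = ∑ e ∈ F with UV.compress {x} {y} e ∈ F, ∑ i ∈ e, (i : ℕ) +
      ∑ e ∈ F with UV.compress {x} {y} e ∉ F, ∑ i ∈ UV.compress {x} {y} e, (i : ℕ) := by
  rw [weight, UV.compression, sum_union UV.compress_disjoint, filter_image,
    sum_image UV.compress_injOn]

theorem weight_compression_le {x y : Fin n} (hxy : x < y) (F : Finset (Finset (Fin n))) :
    weight (UV.compression {x} {y} F) ≤ weight F := by
  rw [weight_compression, weight, ← sum_filter_add_sum_filter_not F
    (fun e => UV.compress {x} {y} e ∈ F)]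
  exact Nat.add_le_add_left (sum_le_sum fun e _ => sum_compress_le hxy e) _

theorem weight_compression_lt {x y : Fin n} (hxy : x < y) {e : Finset (Fin n)} (he : e ∈ F)
    (hx : x ∉ e) (hy : y ∈ e) (hF : insert x (e.erase y) ∉ F) :
    weight (UV.compression {x} {y} F) < weight F := by
  rw [weight_compression, weight, ← sum_filter_add_sum_filter_not F
    (fun e => UV.compress {x} {y} e ∈ F)]
  refine Nat.add_lt_add_left (sum_lt_sum (fun e _ => sum_compress_le hxy e) ⟨e, ?_, ?_⟩) _
  · rw [mem_filter, compress_singleton_of_mem hx hy]; exact ⟨he, hF⟩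
  · rw [compress_singleton_of_mem hx hy]; exact sum_shift_lt hxy hx hy

/-- Shifts towards smaller elements never raise the weight and lower it strictly at any failure of
stability, so the process ends. -/
theorem exists_stable_nearTwins (hℓ : ℓ < r) (hI : IsMaxIntersecting r ℓ I)
    (hJ : IsMaxIntersecting r ℓ J) (hIJ : NearTwins I J) :
    ∃ I' J' : Finset (Finset (Fin n)), IsMaxIntersecting r ℓ I' ∧ IsMaxIntersecting r ℓ J' ∧
      NearTwins I' J' ∧ IsStable I' ∧ IsStable J' := by
  induction hw : weight I + weight J using Nat.strong_induction_on generalizing I J with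
  | _ w ih =>
  subst hw
  have step : ∀ x y : Fin n, weight (UV.compression {x} {y} I) +
      weight (UV.compression {x} {y} J) < weight I + weight J → _ := fun x y h =>
    ih _ h (hI.compression x y) (hJ.compression x y) (hIJ.compression hI hJ hℓ x y) rfl
  by_cases hsI : IsStable I
  · by_cases hsJ : IsStable J
    · exact ⟨I, J, hI, hJ, hIJ, hsI, hsJ⟩
    · simp only [IsStable, not_forall] at hsJ
      obtain ⟨e, he, x, y, hxy, hx, hy, h⟩ := hsJ
      exact step x y (Nat.add_lt_add_of_le_of_lt (weight_compression_le hxy I)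
        (weight_compression_lt hxy he hx hy h))
  · simp only [IsStable, not_forall] at hsI
    obtain ⟨e, he, x, y, hxy, hx, hy, h⟩ := hsI
    exact step x y (Nat.add_lt_add_of_lt_of_le (weight_compression_lt hxy he hx hy h)
      (weight_compression_le hxy J))

/-- The elements of `e` among the first `k`. -/
def trace (k : ℕ) (e : Finset (Fin n)) : Finset (Fin n) := e.filter fun i => (i : ℕ) < k

theorem mem_trace {k : ℕ} {e : Finset (Fin n)} {i : Fin n} :
    i ∈ trace k e ↔ i ∈ e ∧ (i : ℕ) < k := mem_filter

/-- Members of a stable intersecting family already meet within the first `2r - ℓ` elements. -/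
theorem IsStable.le_card_trace_inter (hs : IsStable F) (hF : IsIntersectingFamily r ℓ F)
    (hn : 2 * r - ℓ ≤ n) {g h : Finset (Fin n)} (hg : g ∈ F) (hh : h ∈ F) :
    ℓ ≤ (trace (2 * r - ℓ) (g ∩ h)).card := by
  induction hw : ∑ i ∈ g, (i : ℕ) using Nat.strong_induction_on generalizing g with
  | _ w ih =>
  subst hw
  by_contra! hlt
  obtain ⟨y, hy, hyk⟩ : ∃ y ∈ g ∩ h, y ∉ trace (2 * r - ℓ) (g ∩ h) := by
    by_contra! hsub
    exact hlt.not_ge ((hF.2 g hg h hh).trans (card_le_card hsub))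
  have hyk' : 2 * r - ℓ ≤ (y : ℕ) := by
    by_contra! h; exact hyk (mem_trace.2 ⟨hy, h⟩)
  rw [mem_inter] at hy
  -- `g ∪ h` has at most `2r - ℓ` elements, one of which is `y`, beyond the initial segment; hence
  -- it misses some `x` inside it. Replacing `y` by `x` in `g` gains no common element.
  obtain ⟨x, hxk, hx⟩ : ∃ x : Fin n, (x : ℕ) < 2 * r - ℓ ∧ x ∉ g ∪ h := by
    by_contra! hall
    have hsub : insert y (trace (2 * r - ℓ) univ) ⊆ g ∪ h := by
      intro z; rw [mem_insert, mem_trace]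
      rintro (rfl | hz)
      · exact mem_union_left _ hy.1
      · exact hall z hz.2
    have hc := card_le_card hsub
    have huniv : (trace (2 * r - ℓ) (univ : Finset (Fin n))).card = 2 * r - ℓ := by
      rw [trace, Fin.card_filter_val_lt, min_eq_right hn]
    rw [card_insert_of_notMem (by rw [mem_trace]; omega), huniv] at hc
    have := card_union_add_card_inter g h
    have := hF.2 g hg h hh
    rw [hF.1 g hg, hF.1 h hh] at *
    omega
  rw [mem_union, not_or] at hx
  have hxy : x < y := Fin.lt_def.2 (by omega)
  have := ih _ (sum_shift_lt hxy hx.1 hy.1) (hs g hg x y hxy hx.1 hy.1) rfl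
  refine (this.trans (card_le_card ?_)).not_gt hlt
  intro z
  simp only [mem_trace, mem_inter, mem_insert, mem_erase]
  rintro ⟨⟨rfl | h1, h2⟩, h3⟩
  · exact absurd h2 hx.2
  · exact ⟨⟨h1.2, h2⟩, h3⟩

/-- Membership in a stable family of maximum size depends only on the first `2r - ℓ` elements. -/
theorem IsStable.mem_of_trace_eq (hs : IsStable I) (hI : IsMaxIntersecting r ℓ I) (hℓ : ℓ ≤ r)
    (hn : 2 * r - ℓ ≤ n) {g g' : Finset (Fin n)} (hg : g ∈ I) (hg' : g'.card = r)
    (ht : trace (2 * r - ℓ) g' = trace (2 * r - ℓ) g) : g' ∈ I := by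
  by_contra hn'
  -- Each `h ∈ I` meets `g` in `ℓ` elements of the initial segment, where `g'` agrees with `g`.
  have key : ∀ h ∈ I, ℓ ≤ (g' ∩ h).card := by
    intro h hh
    refine (hs.le_card_trace_inter hI.1 hn hg hh).trans (card_le_card ?_)
    intro z hz
    simp only [mem_trace, mem_inter] at hz ⊢
    have : z ∈ trace (2 * r - ℓ) g' := by rw [ht, mem_trace]; tauto
    exact ⟨(mem_trace.1 this).1, hz.1.2⟩
  have := hI.2 (insert g' I) ⟨?_, ?_⟩
  · rw [card_insert_of_notMem hn'] at this; omega
  · simp only [mem_insert]; rintro g (rfl | hg)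
    · exact hg'
    · exact hI.1.1 g hg
  · simp only [mem_insert]; rintro g (rfl | hg) h (rfl | hh)
    · rw [inter_self, hg']; exact hℓ
    · exact key h hh
    · rw [inter_comm]; exact key g hg
    · exact hI.1.2 g hg h hh

theorem NearTwins.eq_of_notMem {V : Type*} [DecidableEq V] {I J : Finset (Finset V)}
    (h : NearTwins I J) {e g : Finset V} (he : e ∈ I) (heJ : e ∉ J) (hg : g ∈ I) (hgJ : g ∉ J) :
    g = e := by
  by_contra hne
  have : insert g (insert e (I ∩ J)) ⊆ I := by
    intro z; simp only [mem_insert, mem_inter]; rintro (rfl | rfl | h) <;> tauto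
  have := card_le_card this
  rw [card_insert_of_notMem (by simp [hne, hgJ]), card_insert_of_notMem (by simp [heJ])] at this
  have := h.2
  omega

theorem card_shift {V : Type*} [DecidableEq V] {e : Finset V} {x y : V} (hx : x ∉ e) (hy : y ∈ e) :
    (insert x (e.erase y)).card = e.card := by
  rw [card_insert_of_notMem (by simp [hx]), card_erase_add_one hy]

/-- In stable near twins, the member of the first outside the second contains either all or none
of the elements beyond the first `2r - ℓ`. -/
theorem NearTwins.mem_of_le (hIJ : NearTwins I J) (hsI : IsStable I) (hsJ : IsStable J)
    (hI : IsMaxIntersecting r ℓ I) (hJ : IsMaxIntersecting r ℓ J) (hℓ : ℓ ≤ r)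
    (hn : 2 * r - ℓ ≤ n) {e : Finset (Fin n)} (he : e ∈ I) (heJ : e ∉ J) {y z : Fin n}
    (hy : y ∈ e) (hyk : 2 * r - ℓ ≤ (y : ℕ)) (hzk : 2 * r - ℓ ≤ (z : ℕ)) : z ∈ e := by
  by_contra hz
  -- Exchanging `y` for `z` leaves the trace unchanged. The new set is in `I` and is not `e`, so it
  -- is in `J`, and its trace then puts `e` in `J`.
  have ht : trace (2 * r - ℓ) (insert z (e.erase y)) = trace (2 * r - ℓ) e := by
    ext w
    simp only [mem_trace, mem_insert, mem_erase]
    constructor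
    · rintro ⟨rfl | h, h'⟩
      · omega
      · exact ⟨h.2, h'⟩
    · rintro ⟨h, h'⟩
      exact ⟨.inr ⟨by rintro rfl; omega, h⟩, h'⟩
  have hc := card_shift hz hy
  have hm := hsI.mem_of_trace_eq hI hℓ hn he (hc.trans (hI.1.1 e he)) ht
  have hmJ : insert z (e.erase y) ∈ J := by
    by_contra h
    have := hIJ.eq_of_notMem he heJ hm h
    exact hz (this ▸ mem_insert_self _ _)
  exact heJ (hsJ.mem_of_trace_eq hJ hℓ hn hmJ (hI.1.1 e he) ht.symm)

/-- Here `e` contains everything beyond the segment, so each `x ∉ e` can replace `y`. The result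
lies in `J` and meets `f` in `ℓ` elements while `e` does not; so `x ∈ f` and `e ∩ f` has `ℓ - 1`
elements. Thus `e ∪ f` is everything and `n = 2r - ℓ + 1`. -/
theorem NearTwins.false_of_mem (hIJ : NearTwins I J) (hsI : IsStable I) (hsJ : IsStable J)
    (hI : IsMaxIntersecting r ℓ I) (hJ : IsMaxIntersecting r ℓ J) (hℓ : ℓ < r)
    (hn : 2 * r - ℓ + 1 < n) {e f : Finset (Fin n)} (he : e ∈ I) (heJ : e ∉ J) (hf : f ∈ J)
    (hfI : f ∉ I) {y : Fin n} (hy : y ∈ e) (hyk : 2 * r - ℓ ≤ (y : ℕ)) : False := by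
  have hlt := hI.card_inter_lt hJ.1 hIJ hℓ.le he heJ hf hfI
  have hfull : ∀ z : Fin n, 2 * r - ℓ ≤ (z : ℕ) → z ∈ e := fun z hz =>
    hIJ.mem_of_le hsI hsJ hI hJ hℓ.le (by omega) he heJ hy hyk hz
  have her := hI.1.1 e he
  have hfr := hJ.1.1 f hf
  have key : ∀ x : Fin n, x ∉ e → x ∈ f ∧ ℓ ≤ (e ∩ f).card + 1 := by
    intro x hx
    have hxy : x < y := by
      rw [Fin.lt_def]; by_contra! h
      exact hx (hfull x (by omega))
    have hm := hsI e he x y hxy hx hy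
    have hmJ : insert x (e.erase y) ∈ J := by
      by_contra h
      exact hx (hIJ.eq_of_notMem he heJ hm h ▸ mem_insert_self _ _)
    have hint := hJ.1.2 _ hmJ f hf
    constructor
    · by_contra hxf
      rw [insert_inter_of_notMem hxf] at hint
      exact (hint.trans (card_le_card (inter_subset_inter_right (erase_subset _ _)))).not_gt hlt
    · refine hint.trans ((card_le_card (t := insert x (e ∩ f)) ?_).trans (card_insert_le _ _))
      intro z; simp only [mem_inter, mem_insert, mem_erase]; tauto
  have hcu : (e ∪ f).card = n := by
    have : e ∪ f = univ := by
      ext x; simp only [mem_union, mem_univ, iff_true]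
      by_cases hx : x ∈ e
      · exact .inl hx
      · exact .inr (key x hx).1
    rw [this, card_univ, Fintype.card_fin]
  have := card_union_add_card_inter e f
  obtain ⟨x, hx⟩ : ∃ x, x ∉ e := by
    by_contra! h
    have : e = univ := by ext x; simp [h x]
    rw [this, card_univ, Fintype.card_fin] at her
    omega
  have := (key x hx).2
  omega

/-- By `NearTwins.false_of_mem` both exceptional members lie in the first `2r - ℓ` elements, where
two `r`-sets must share `ℓ`. -/
theorem not_nearTwins_of_lt (hℓ : ℓ < r) (hn : 2 * r - ℓ + 1 < n) (hI : IsMaxIntersecting r ℓ I)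
    (hJ : IsMaxIntersecting r ℓ J) : ¬ NearTwins I J := by
  intro hIJ
  obtain ⟨I, J, hI, hJ, hIJ, hsI, hsJ⟩ := exists_stable_nearTwins hℓ hI hJ hIJ
  have hc : I.card = J.card := le_antisymm (hJ.2 _ hI.1) (hI.2 _ hJ.1)
  obtain ⟨e, he, heJ⟩ := hIJ.exists_mem hc
  obtain ⟨f, hf, hfI⟩ := (hIJ.symm hc).exists_mem hc.symm
  have h1 : ∀ y ∈ e, (y : ℕ) < 2 * r - ℓ := by
    intro y hy; by_contra! hyk
    exact hIJ.false_of_mem hsI hsJ hI hJ hℓ hn he heJ hf hfI hy hyk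
  have h2 : ∀ y ∈ f, (y : ℕ) < 2 * r - ℓ := by
    intro y hy; by_contra! hyk
    exact (hIJ.symm hc).false_of_mem hsJ hsI hJ hI hℓ hn hf hfI he heJ hy hyk
  have hlt := hI.card_inter_lt hJ.1 hIJ hℓ.le he heJ hf hfI
  have hsub : e ∪ f ⊆ trace (2 * r - ℓ) univ := by
    intro z hz; rw [mem_trace]
    rcases mem_union.1 hz with h | h
    · exact ⟨mem_univ _, h1 z h⟩
    · exact ⟨mem_univ _, h2 z h⟩
  have hcard := card_le_card hsub
  rw [trace, Fin.card_filter_val_lt] at hcard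
  have := card_union_add_card_inter e f
  have := hI.1.1 e he
  have := hJ.1.1 f hf
  omega

theorem card_compl_inter (e f : Finset (Fin n)) :
    (eᶜ ∩ fᶜ).card + e.card + f.card = n + (e ∩ f).card := by
  have := card_union_add_card_inter e f
  have h2 := card_add_card_compl (e ∪ f)
  rw [compl_union, Fintype.card_fin] at h2
  omega

theorem IsIntersectingFamily.image_compl {s m : ℕ} (hF : IsIntersectingFamily r ℓ F)
    (hs : s + r = n) (hm : m + 2 * r ≤ n + ℓ) :
    IsIntersectingFamily s m (F.image compl) := by
  constructor
  · simp only [mem_image, forall_exists_index, and_imp]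
    rintro _ e he rfl
    rw [card_compl, Fintype.card_fin, hF.1 e he]; omega
  · simp only [mem_image, forall_exists_index, and_imp]
    rintro _ e he rfl _ f hf rfl
    have := card_compl_inter e f
    have := hF.1 e he
    have := hF.1 f hf
    have := hF.2 e he f hf
    omega

/-- Equality in `hm` makes complementation reversible between the two kinds of family, so maximality
transfers. -/
theorem IsMaxIntersecting.image_compl {s m : ℕ} (hI : IsMaxIntersecting r ℓ I)
    (hs : s + r = n) (hm : m + 2 * r = n + ℓ) : IsMaxIntersecting s m (I.image compl) := by
  refine ⟨hI.1.image_compl hs hm.le, fun G hG => ?_⟩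
  rw [card_image_of_injective _ compl_injective, ← card_image_of_injective G compl_injective]
  exact hI.2 _ (hG.image_compl (by omega) (by omega))

theorem NearTwins.image_compl (h : NearTwins I J) : NearTwins (I.image compl) (J.image compl) := by
  refine ⟨fun h' => h.1 (image_injective compl_injective h'), ?_⟩
  rw [← image_inter _ _ compl_injective, card_image_of_injective _ compl_injective,
    card_image_of_injective _ compl_injective]
  exact h.2

/-- Two distinct largest intersecting families cannot differ in a single member, except for
intersecting families of `r`-subsets of a `2r`-set. -/
theorem not_nearTwins (hℓ0 : 0 < ℓ) (hℓ : ℓ < r) (hrn : r ≤ n) (hne : ¬ (ℓ = 1 ∧ n = 2 * r))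
    (hI : IsMaxIntersecting r ℓ I) (hJ : IsMaxIntersecting r ℓ J) : ¬ NearTwins I J := by
  intro hIJ
  rcases lt_trichotomy n (2 * r - ℓ + 1) with hn | hn | hn
  -- For `n ≤ 2r - ℓ` any two `r`-sets share `ℓ` elements.
  · have hc : I.card = J.card := le_antisymm (hJ.2 _ hI.1) (hI.2 _ hJ.1)
    obtain ⟨e, he, heJ⟩ := hIJ.exists_mem hc
    obtain ⟨f, hf, hfI⟩ := (hIJ.symm hc).exists_mem hc.symm
    have := hI.card_inter_lt hJ.1 hIJ hℓ.le he heJ hf hfI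
    have := card_compl_inter e f
    have := hI.1.1 e he
    have := hJ.1.1 f hf
    omega
  -- Complements are 1-intersecting `(n - r)`-sets, and `2(n - r) < n` holds exactly when `ℓ > 1`;
  -- `ℓ = 1` would give the excluded `n = 2r`.
  · exact not_nearTwins_of_lt (r := n - r) (ℓ := 1) (by omega) (by omega)
      (hI.image_compl (by omega) (by omega)) (hJ.image_compl (by omega) (by omega))
      hIJ.image_compl
  · exact not_nearTwins_of_lt hℓ hn hI hJ hIJ

end Stable

/-! ### Counting Kneser colorings through the conflict graph. -/

section Kneser

variable {n r ℓ : ℕ} {H : FinHypergraph (Fin n)}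

theorem card_twoEdges_left (r i : ℕ) (hi : i ≤ r) :
    (univ.filter (fun v : Fin (2 * r - i) => (v : ℕ) < r)).card = r := by
  rw [Fin.card_filter_val_lt]; omega

theorem card_filter_le_val (m k : ℕ) :
    (univ.filter (fun v : Fin m => k ≤ (v : ℕ))).card = m - k := by
  have h := card_filter_add_card_filter_not (s := univ) (fun v : Fin m => (v : ℕ) < k)
  simp only [not_lt, Fin.card_filter_val_lt, card_univ, Fintype.card_fin] at h
  omega

theorem card_twoEdges_right (r i : ℕ) (hi : i ≤ r) :
    (univ.filter (fun v : Fin (2 * r - i) => r - i ≤ (v : ℕ))).card = r := by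
  rw [card_filter_le_val]; omega

theorem twoEdges_union (r i : ℕ) :
    (univ.filter (fun v : Fin (2 * r - i) => (v : ℕ) < r)) ∪
      (univ.filter (fun v : Fin (2 * r - i) => r - i ≤ (v : ℕ))) = univ := by
  ext v; simp only [mem_union, mem_filter, mem_univ, true_and, iff_true]; omega

/-- Two pairs of sets with the same sizes and equally large intersections are isomorphic. -/
theorem exists_embedding_map_eq {V W : Type*} [DecidableEq V] [DecidableEq W] [Fintype W]
    {A B : Finset W} {e f : Finset V} (hAB : A ∪ B = univ) (hA : A.card = e.card)
    (hB : B.card = f.card) (hi : (A ∩ B).card = (e ∩ f).card) :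
    ∃ φ : W ↪ V, A.map φ = e ∧ B.map φ = f := by
  have h1 : (A \ B).card = (e \ f).card := by
    rw [card_sdiff, card_sdiff, inter_comm B, inter_comm f]; omega
  have h3 : (B \ A).card = (f \ e).card := by
    rw [card_sdiff, card_sdiff]; omega
  let g1 := equivOfCardEq h1
  let g2 := equivOfCardEq hi
  let g3 := equivOfCardEq h3
  have hB' : ∀ v, v ∉ A → v ∈ B := fun v hv =>
    (mem_union.1 (hAB ▸ mem_univ v)).resolve_left hv
  let φ : W → V := fun v => if hA : v ∈ A then
      if hB : v ∈ B then g2 ⟨v, mem_inter.2 ⟨hA, hB⟩⟩ else g1 ⟨v, mem_sdiff.2 ⟨hA, hB⟩⟩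
    else g3 ⟨v, mem_sdiff.2 ⟨hB' v hA, hA⟩⟩
  have φ1 : ∀ v (hA : v ∈ A) (hB : v ∉ B), φ v = g1 ⟨v, mem_sdiff.2 ⟨hA, hB⟩⟩ := by
    intro v hA hB; simp only [φ, dif_pos hA, dif_neg hB]
  have φ2 : ∀ v (hA : v ∈ A) (hB : v ∈ B), φ v = g2 ⟨v, mem_inter.2 ⟨hA, hB⟩⟩ := by
    intro v hA hB; simp only [φ, dif_pos hA, dif_pos hB]
  have φ3 : ∀ v (hA : v ∉ A), φ v = g3 ⟨v, mem_sdiff.2 ⟨hB' v hA, hA⟩⟩ := by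
    intro v hA; simp only [φ, dif_neg hA]
  have me : ∀ v, φ v ∈ e ↔ v ∈ A := by
    intro v
    by_cases hA : v ∈ A
    · by_cases hB : v ∈ B
      · rw [φ2 v hA hB]; exact iff_of_true (mem_inter.1 (g2 _).2).1 hA
      · rw [φ1 v hA hB]; exact iff_of_true (mem_sdiff.1 (g1 _).2).1 hA
    · rw [φ3 v hA]; exact iff_of_false (mem_sdiff.1 (g3 _).2).2 hA
  have mf : ∀ v, φ v ∈ f ↔ v ∈ B := by
    intro v
    by_cases hA : v ∈ A
    · by_cases hB : v ∈ B
      · rw [φ2 v hA hB]; exact iff_of_true (mem_inter.1 (g2 _).2).2 hB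
      · rw [φ1 v hA hB]; exact iff_of_false (mem_sdiff.1 (g1 _).2).2 hB
    · rw [φ3 v hA]; exact iff_of_true (mem_sdiff.1 (g3 _).2).1 (hB' v hA)
  have hφ : Function.Injective φ := by
    intro v w h
    have hvA : v ∈ A ↔ w ∈ A := by rw [← me, ← me, h]
    have hvB : v ∈ B ↔ w ∈ B := by rw [← mf, ← mf, h]
    by_cases hA : v ∈ A
    · by_cases hB : v ∈ B
      · rw [φ2 v hA hB, φ2 w (hvA.1 hA) (hvB.1 hB)] at h
        simpa using g2.injective (Subtype.ext h)
      · rw [φ1 v hA hB, φ1 w (hvA.1 hA) (mt hvB.2 hB)] at h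
        simpa using g1.injective (Subtype.ext h)
    · rw [φ3 v hA, φ3 w (mt hvA.2 hA)] at h
      simpa using g3.injective (Subtype.ext h)
  refine ⟨⟨φ, hφ⟩, eq_of_subset_of_card_le ?_ ?_, eq_of_subset_of_card_le ?_ ?_⟩
  · intro z; rw [mem_map]; rintro ⟨v, hv, rfl⟩; exact (me v).2 hv
  · rw [card_map, hA]
  · intro z; rw [mem_map]; rintro ⟨v, hv, rfl⟩; exact (mf v).2 hv
  · rw [card_map, hB]

theorem card_twoEdges_inter {r i : ℕ} (hi : i ≤ r) :
    ((univ.filter (fun v : Fin (2 * r - i) => (v : ℕ) < r)) ∩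
      (univ.filter (fun v : Fin (2 * r - i) => r - i ≤ (v : ℕ)))).card = i := by
  have := card_union_add_card_inter (univ.filter (fun v : Fin (2 * r - i) => (v : ℕ) < r))
    (univ.filter (fun v : Fin (2 * r - i) => r - i ≤ (v : ℕ)))
  rw [twoEdges_union, card_twoEdges_left r i hi, card_twoEdges_right r i hi, card_univ,
    Fintype.card_fin] at this
  omega

theorem isFree_nonIntersectingPairs_iff {V : Type*} [DecidableEq V] {H : FinHypergraph V}
    (hℓ : ℓ ≤ r) (hH : H.IsUniform r) :
    H.IsFree (nonIntersectingPairs r ℓ) ↔ IsIntersectingFamily r ℓ H := by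
  constructor
  · refine fun h => ⟨hH, fun e he f hf => ?_⟩
    by_contra! hlt
    refine h _ ⟨_, hlt, rfl⟩ ?_
    obtain ⟨φ, h1, h2⟩ := exists_embedding_map_eq (twoEdges_union r (e ∩ f).card)
      ((card_twoEdges_left r _ (by omega)).trans (hH e he).symm)
      ((card_twoEdges_right r _ (by omega)).trans (hH f hf).symm)
      (card_twoEdges_inter (by omega))
    refine ⟨φ, ?_⟩
    simp only [twoEdges, mem_insert, mem_singleton]
    rintro _ (rfl | rfl)
    · rwa [h1]
    · rwa [h2]
  · rintro h _ ⟨i, hi, rfl⟩ ⟨φ, hφ⟩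
    have := h.2 _ (hφ _ (mem_insert_self _ _)) _ (hφ _ (mem_insert_of_mem (mem_singleton_self _)))
    rw [← map_inter, card_map, card_twoEdges_inter (by omega)] at this
    omega

theorem le_ex {G : Finset (Finset (Fin n))} (hℓ : ℓ ≤ r) (hG : IsIntersectingFamily r ℓ G) :
    G.card ≤ ex n r (nonIntersectingPairs r ℓ) := by
  classical
  exact le_sup (f := Finset.card) (mem_filter.2
    ⟨mem_univ G, hG.1, (isFree_nonIntersectingPairs_iff hℓ hG.1).2 hG⟩)

theorem exists_card_eq_ex (n : ℕ) (hℓ : ℓ ≤ r) : ∃ G : Finset (Finset (Fin n)),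
    IsIntersectingFamily r ℓ G ∧ G.card = ex n r (nonIntersectingPairs r ℓ) := by
  classical
  obtain ⟨G, hG, h⟩ := exists_mem_eq_sup (univ.filter fun H : FinHypergraph (Fin n) =>
      H.IsUniform r ∧ H.IsFree (nonIntersectingPairs r ℓ))
    ⟨∅, mem_filter.2 ⟨mem_univ _, by simp [IsUniform], (isFree_nonIntersectingPairs_iff hℓ
      (by simp [IsUniform])).2 (by simp [IsIntersectingFamily])⟩⟩ Finset.card
  rw [mem_filter] at hG
  exact ⟨G, (isFree_nonIntersectingPairs_iff hℓ hG.2.1).1 hG.2.2, h.symm⟩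

theorem isMaxIntersecting_of_card_eq_ex {G : Finset (Finset (Fin n))} (hℓ : ℓ ≤ r)
    (hG : IsIntersectingFamily r ℓ G) (h : G.card = ex n r (nonIntersectingPairs r ℓ)) :
    IsMaxIntersecting r ℓ G := ⟨hG, fun _ hF => (le_ex hℓ hF).trans h.ge⟩

/-- The graph on the hyperedges of `H` whose edges join hyperedges sharing fewer than `ℓ`
vertices. -/
def conflictGraph {V : Type*} [DecidableEq V] (H : FinHypergraph V) (ℓ : ℕ) :
    SimpleGraph {e // e ∈ H} where
  Adj e f := e ≠ f ∧ (e.1 ∩ f.1).card < ℓ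
  symm := ⟨fun e f h => ⟨h.1.symm, by rw [inter_comm]; exact h.2⟩⟩
  loopless := ⟨fun _ h => h.1 rfl⟩

theorem kappa_of_isIntersectingFamily {V : Type*} [DecidableEq V] {H : FinHypergraph V}
    (hH : IsIntersectingFamily r ℓ H) (k : ℕ) : H.kappa k ℓ = k ^ H.card := by
  have : ∀ Δ : {e // e ∈ H} → Fin k, H.IsKneserColoring k ℓ Δ :=
    fun Δ e f _ _ => hH.2 e.1 e.2 f.1 f.2
  rw [kappa, Nat.card_congr (Equiv.subtypeUnivEquiv this), Nat.card_eq_fintype_card]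
  simp

/-- A 2-coloring is determined by its values on one hyperedge of each component. -/
theorem kappa_two_le {V : Type*} [DecidableEq V] (H : FinHypergraph V) (ℓ : ℕ) :
    H.kappa 2 ℓ ≤ 2 ^ Nat.card (H.conflictGraph ℓ).ConnectedComponent := by
  have hcard : Nat.card ((H.conflictGraph ℓ).ConnectedComponent → Fin 2) =
      2 ^ Nat.card (H.conflictGraph ℓ).ConnectedComponent := by
    rw [Nat.card_fun, Nat.card_fin]
  rw [← hcard]
  refine Nat.card_le_card_of_injective (fun Δ c => Δ.1 c.out) fun Δ Δ' h => Subtype.ext ?_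
  -- With two colors, the color at one end of a conflict edge forces the other.
  have hadj : ∀ e f, (H.conflictGraph ℓ).Adj e f → Δ.1 e = Δ'.1 e → Δ.1 f = Δ'.1 f := by
    intro e f hef heq
    have h1 : Δ.1 e ≠ Δ.1 f := fun h => (Δ.2 e f hef.1 h).not_gt hef.2
    have h2 : Δ'.1 e ≠ Δ'.1 f := fun h => (Δ'.2 e f hef.1 h).not_gt hef.2
    omega
  have hwalk : ∀ e f, (H.conflictGraph ℓ).Walk e f → Δ.1 e = Δ'.1 e → Δ.1 f = Δ'.1 f := by
    intro e f w
    induction w with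
    | nil => exact id
    | cons h _ ih => exact fun h' => ih (hadj _ _ h h')
  funext e
  obtain ⟨w⟩ : (H.conflictGraph ℓ).Reachable
      ((H.conflictGraph ℓ).connectedComponentMk e).out e :=
    SimpleGraph.ConnectedComponent.exact (Quot.out_eq _)
  exact hwalk _ _ w (congrFun h _)

/-- A choice of one hyperedge from each component of the conflict graph. -/
def IsTransversal {V : Type*} [DecidableEq V] (H : FinHypergraph V) (ℓ : ℕ)
    (s : (H.conflictGraph ℓ).ConnectedComponent → {e // e ∈ H}) : Prop :=
  ∀ c, (H.conflictGraph ℓ).connectedComponentMk (s c) = c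

section Transversal

variable {V : Type*} [DecidableEq V] {H : FinHypergraph V}
  {s : (H.conflictGraph ℓ).ConnectedComponent → {e // e ∈ H}}

theorem IsTransversal.injective (hs : H.IsTransversal ℓ s) :
    Function.Injective fun c => (s c).1 := by
  intro c d h
  rw [← hs c, ← hs d, Subtype.ext h]

variable [Fintype (H.conflictGraph ℓ).ConnectedComponent]

theorem IsTransversal.card_image (hs : H.IsTransversal ℓ s) :
    (univ.image fun c => (s c).1).card = Nat.card (H.conflictGraph ℓ).ConnectedComponent := by
  rw [card_image_of_injective _ hs.injective, card_univ, Nat.card_eq_fintype_card]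

theorem IsTransversal.isIntersectingFamily (hs : H.IsTransversal ℓ s) (hℓ : ℓ ≤ r)
    (hH : H.IsUniform r) : IsIntersectingFamily r ℓ (univ.image fun c => (s c).1) := by
  constructor
  · simp only [mem_image, mem_univ, true_and, forall_exists_index]
    rintro _ c rfl
    exact hH _ (s c).2
  · simp only [mem_image, mem_univ, true_and, forall_exists_index]
    rintro _ c rfl _ d rfl
    by_cases hcd : s c = s d
    · rw [hcd, inter_self, hH _ (s d).2]; exact hℓ
    · by_contra! hlt
      have hadj : (H.conflictGraph ℓ).Adj (s c) (s d) := ⟨hcd, hlt⟩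
      apply hcd
      have : c = d := by
        rw [← hs c, ← hs d]
        exact SimpleGraph.ConnectedComponent.sound hadj.reachable
      rw [this]

end Transversal

theorem isTransversal_out {V : Type*} [DecidableEq V] (H : FinHypergraph V) (ℓ : ℕ) :
    H.IsTransversal ℓ fun c => c.out := fun c => Quot.out_eq c

theorem card_connectedComponent_le_ex (hℓ : ℓ ≤ r) (hH : H.IsUniform r) :
    Nat.card (H.conflictGraph ℓ).ConnectedComponent ≤ ex n r (nonIntersectingPairs r ℓ) := by
  classical
  have hs := H.isTransversal_out ℓ
  rw [← hs.card_image]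
  exact le_ex hℓ (hs.isIntersectingFamily hℓ hH)

theorem kappa_two_le_two_pow_ex (hℓ : ℓ ≤ r) (hH : H.IsUniform r) :
    H.kappa 2 ℓ ≤ 2 ^ ex n r (nonIntersectingPairs r ℓ) :=
  (H.kappa_two_le ℓ).trans
    (Nat.pow_le_pow_right two_pos (card_connectedComponent_le_ex hℓ hH))

theorem KC_two (n : ℕ) (hℓ : ℓ ≤ r) :
    KC n r 2 ℓ = 2 ^ ex n r (nonIntersectingPairs r ℓ) := by
  classical
  apply le_antisymm
  · exact Finset.sup_le fun H hH => kappa_two_le_two_pow_ex hℓ (mem_filter.1 hH).2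
  · obtain ⟨G, hG, h⟩ := exists_card_eq_ex n hℓ
    rw [← h, ← kappa_of_isIntersectingFamily hG]
    exact le_sup (f := fun H : FinHypergraph (Fin n) => H.kappa 2 ℓ)
      (mem_filter.2 ⟨mem_univ G, hG.1⟩)

theorem isIntersectingFamily_of_kappa_eq (hℓ0 : 0 < ℓ) (hℓ : ℓ < r) (hrn : r ≤ n)
    (hne : ¬ (ℓ = 1 ∧ n = 2 * r)) (hH : H.IsUniform r)
    (hκ : H.kappa 2 ℓ = 2 ^ ex n r (nonIntersectingPairs r ℓ)) :
    IsIntersectingFamily r ℓ H := by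
  classical
  refine ⟨hH, fun e he f hf => ?_⟩
  by_contra! hlt
  have hcard : Nat.card (H.conflictGraph ℓ).ConnectedComponent =
      ex n r (nonIntersectingPairs r ℓ) :=
    le_antisymm (card_connectedComponent_le_ex hℓ.le hH)
      ((Nat.pow_le_pow_iff_right one_lt_two).1 (hκ.symm.le.trans (H.kappa_two_le ℓ)))
  have hef : e ≠ f := by
    rintro rfl
    rw [inter_self, hH e he] at hlt
    omega
  have hadj : (H.conflictGraph ℓ).Adj ⟨e, he⟩ ⟨f, hf⟩ := ⟨fun h => hef (congrArg Subtype.val h), hlt⟩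
  have hc := SimpleGraph.ConnectedComponent.sound hadj.reachable
  set c := (H.conflictGraph ℓ).connectedComponentMk ⟨e, he⟩ with hce
  -- `u g` represents component `c` by `g` and every other component by its default representative.
  let u : {e // e ∈ H} → (H.conflictGraph ℓ).ConnectedComponent → {e // e ∈ H} :=
    fun g => Function.update (fun d => d.out) c g
  have u_self : ∀ g, u g c = g := fun g => Function.update_self _ _ _
  have u_ne : ∀ g d, d ≠ c → u g d = d.out := fun g d hd => Function.update_of_ne hd _ _
  have hupd : ∀ g : {e // e ∈ H}, (H.conflictGraph ℓ).connectedComponentMk g = c →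
      H.IsTransversal ℓ (u g) := by
    intro g hg d
    by_cases hd : d = c
    · rw [hd, u_self, hg]
    · rw [u_ne _ _ hd]; exact H.isTransversal_out ℓ d
  have hs := hupd ⟨e, he⟩ rfl
  have ht := hupd ⟨f, hf⟩ hc.symm
  have hmax : ∀ {s}, H.IsTransversal ℓ s → IsMaxIntersecting r ℓ (univ.image fun c => (s c).1) :=
    fun h => isMaxIntersecting_of_card_eq_ex hℓ.le (h.isIntersectingFamily hℓ.le hH)
      (h.card_image.trans hcard)
  refine not_nearTwins hℓ0 hℓ hrn hne (hmax hs) (hmax ht) ⟨fun h => ?_, ?_⟩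
  · have h1 : e ∈ univ.image fun d => (u ⟨e, he⟩ d).1 :=
      mem_image.2 ⟨c, mem_univ _, by rw [u_self]⟩
    have h2 : f ∈ univ.image fun d => (u ⟨f, hf⟩ d).1 :=
      mem_image.2 ⟨c, mem_univ _, by rw [u_self]⟩
    exact ((hs.isIntersectingFamily hℓ.le hH).2 e h1 f (h ▸ h2)).not_gt hlt
  · have hsub : (univ.erase c).image (fun d => (u ⟨e, he⟩ d).1) ⊆
        (univ.image fun d => (u ⟨e, he⟩ d).1) ∩
        (univ.image fun d => (u ⟨f, hf⟩ d).1) := by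
      refine subset_inter (image_subset_image (erase_subset _ _)) ?_
      intro g hg
      obtain ⟨d, hd, rfl⟩ := mem_image.1 hg
      rw [mem_erase] at hd
      exact mem_image.2 ⟨d, mem_univ _, by
        rw [u_ne _ _ hd.1, u_ne _ _ hd.1]⟩
    have := card_le_card hsub
    rw [card_image_of_injective _ hs.injective, card_erase_of_mem (mem_univ _)] at this
    rw [card_image_of_injective _ hs.injective]
    omega

end Kneser

end FinHypergraph

theorem theorem1p1 (n r ℓ : ℕ) (hℓ : 0 < ℓ) (hℓr : ℓ < r) (hrn : r ≤ n) :
    FinHypergraph.KC n r 2 ℓ =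
        2 ^ FinHypergraph.ex n r (FinHypergraph.nonIntersectingPairs r ℓ) ∧
      (∀ H : FinHypergraph (Fin n),
        FinHypergraph.IsExtremal H r (FinHypergraph.nonIntersectingPairs r ℓ) →
          FinHypergraph.kappa H 2 ℓ = FinHypergraph.KC n r 2 ℓ) ∧
      (¬ (ℓ = 1 ∧ n = 2 * r) →
        ∀ H : FinHypergraph (Fin n), FinHypergraph.IsUniform H r →
          FinHypergraph.kappa H 2 ℓ = FinHypergraph.KC n r 2 ℓ →
            FinHypergraph.IsExtremal H r (FinHypergraph.nonIntersectingPairs r ℓ)) := by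
  have hKC := FinHypergraph.KC_two n hℓr.le
  refine ⟨hKC, ?_, ?_⟩
  · rintro H ⟨hu, hfree, hcard⟩
    rw [hKC, ← hcard]
    exact FinHypergraph.kappa_of_isIntersectingFamily
      ((FinHypergraph.isFree_nonIntersectingPairs_iff hℓr.le hu).1 hfree) 2
  · intro hne H hu hκ
    rw [hKC] at hκ
    have hH := FinHypergraph.isIntersectingFamily_of_kappa_eq hℓ hℓr hrn hne hu hκ
    refine ⟨hu, (FinHypergraph.isFree_nonIntersectingPairs_iff hℓr.le hu).2 hH, ?_⟩
    rw [FinHypergraph.kappa_of_isIntersectingFamily hH] at hκ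
    exact Nat.pow_right_injective le_rfl hκ
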